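/- Theorem. (a) Let $V$ be a finite-dimensional real inner product space of dimension $d$. A $j$-polyhedron is a nonempty intersection of finitely many closed halfspaces of $V$ (the empty intersection being $V$) whose affine hull has dimension $j$. A cell complex $C$ in $V$ is a covering of $V$ by finitely many polyhedra, called the faces of $C$, whose relative interiors are pairwise disjoint and whose nonempty intersections are again faces of $C$; its $d$-dimensional faces are its cells. Let $C$ be a cell complex in $V$, let $Z_1,\dots,Z_n$ be its cells (each listed once), and let $p_1,\dots,p_n \in V$ be pairwise distinct points. Then $C$ is a power diagram with sites $\{p_1,\dots,p_n\}$, that is, there are weights $w_1,\dots,w_n\in\mathbb{R}$ such that $$Z_i=\Bigl\{t\in V \;\Big|\; \|p_i-t\|^2-w_i=\min_{1\le j\le n}\bigl(\|p_j-t\|^2-w_j\bigr)\Bigr\}\qquad\text{for all } i,$$ if and only if weak monotonicity holds: for all $i,j$, all $t\in Z_i$ and all $t'\in Z_j$, $$p_i\cdot(t'-t)\le p_j\cdot(t'-t).$$ (b) (Saks--Yu) Let $V$ be a real inner product space, $\mathcal{T}\subseteq V$ a convex set of types, $\mathcal{A}\subset V$ a finite set of allocations, and $a:\mathcal{T}\to\mathcal{A}$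 an allocation rule. Then $a$ is implementable, that is, there is a payment $q:\mathcal{T}\to\mathbb{R}$ with $$a(t')\cdot t-q(t')\le a(t)\cdot t-q(t)\qquad\text{for all } t,t'\in\mathcal{T},$$ if and only if $a$ satisfies weak monotonicity: $a(t)\cdot(t'-t)\le a(t')\cdot(t'-t)$ for all $t,t'\in\mathcal{T}$. -/

import Mathlib

namespace Elicitation

variable {V : Type*} [NormedAddCommGroup V] [InnerProductSpace ℝ V]

/-- A closed halfspace `{x | ⟨a, x⟩ ≤ b}` with `a ≠ 0`. -/
def IsClosedHalfspace (H : Set V) : Prop :=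
  ∃ (a : V) (b : ℝ), a ≠ 0 ∧ H = {x | inner ℝ a x ≤ b}

/-- A `j`-polyhedron: a (nonempty) intersection of finitely many closed halfspaces whose affine
hull has dimension `j`. The whole space is the intersection of the empty family. -/
def IsPolyhedron (j : ℕ) (F : Set V) : Prop :=
  F.Nonempty ∧
  (∃ H : Set (Set V), H.Finite ∧ (∀ h ∈ H, IsClosedHalfspace h) ∧ F = ⋂₀ H) ∧
  Module.finrank ℝ (vectorSpan ℝ F) = j

variable (V) in
/-- A cell complex in `V` (used for finite-dimensional `V`): a covering of `V` by finitely many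
polyhedra, its faces, whose relative interiors are pairwise disjoint and whose nonempty
intersections are again faces of the complex. -/
structure CellComplex where
  faces : Set (Set V)
  finite_faces : faces.Finite
  polyhedral : ∀ F ∈ faces, ∃ j : ℕ, IsPolyhedron j F
  cover : ⋃₀ faces = Set.univ
  disjoint_relint : faces.Pairwise
    (fun F G => Disjoint (intrinsicInterior ℝ F) (intrinsicInterior ℝ G))
  inter_mem : ∀ F ∈ faces, ∀ G ∈ faces, (F ∩ G).Nonempty → F ∩ G ∈ faces

/-- The cells of a cell complex: its faces of full dimension. -/
def CellComplex.cells (C : CellComplex V) : Set (Set V) :=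
  {F | F ∈ C.faces ∧ IsPolyhedron (Module.finrank ℝ V) F}

/-- `Z` lists the cells of `C`, each exactly once. -/
def CellComplex.IsEnumeration (C : CellComplex V) {n : ℕ} (Z : Fin n → Set V) : Prop :=
  Function.Injective Z ∧ Set.range Z = C.cells

/-- The cell of the site `p i` in the power diagram with sites `p` and weights `w`: the points at
which `i` minimizes `j ↦ ‖p j - t‖ ^ 2 - w j`. -/
def powerCell {n : ℕ} (p : Fin n → V) (w : Fin n → ℝ) (i : Fin n) : Set V :=
  {t | ∀ j, ‖p i - t‖ ^ 2 - w i ≤ ‖p j - t‖ ^ 2 - w j}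

/-- The family of sets `Z` is a power diagram with sites `p`: for some weights, `Z i` is the cell
of `p i` for every `i`. -/
def IsPowerDiagram {n : ℕ} (Z : Fin n → Set V) (p : Fin n → V) : Prop :=
  ∃ w : Fin n → ℝ, ∀ i, Z i = powerCell p w i

/-- Weak monotonicity of a family of sets `Z` with sites `p`. -/
def CellsWMON {n : ℕ} (Z : Fin n → Set V) (p : Fin n → V) : Prop :=
  ∀ i j, ∀ t ∈ Z i, ∀ t' ∈ Z j, inner ℝ (p i) (t' - t) ≤ inner ℝ (p j) (t' - t)

/-- Weak monotonicity of an allocation rule. -/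
def RuleWMON {T : Set V} (a : T → V) : Prop :=
  ∀ t t' : T, inner ℝ (a t) ((t' : V) - t) ≤ inner ℝ (a t') ((t' : V) - t)

/-- The utility of the agent with type `t` and report `t'` under the mechanism `(a, q)`. -/
noncomputable def utility {T : Set V} (a : T → V) (q : T → ℝ) (t' t : T) : ℝ :=
  inner ℝ (a t') (t : V) - q t'

/-- The mechanism with allocation rule `a` and payment `q` is truthful. -/
def IsTruthful {T : Set V} (a : T → V) (q : T → ℝ) : Prop :=
  ∀ t t' : T, utility a q t' t ≤ utility a q t t

/-- The allocation rule `a` is implementable: some payment makes it truthful. -/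
def IsImplementable {T : Set V} (a : T → V) : Prop :=
  ∃ q : T → ℝ, IsTruthful a q

end Elicitation

/-!
Both parts rest on one fact: a monotone map `f` with finitely many values on a convex set `T` is a
selection of the subdifferential of a function `φ` on `T`. The function is the path integral
`φ y = segmentIntegral f x₀ y` of `f` along the segment from `x₀` to `y`; monotonicity makes the
integrand monotone along each segment, so that `⟪f x, y - x⟫ ≤ segmentIntegral f x y`, and all that
is needed is path independence, i.e. the vanishing of the integral around every triangle
(`segmentIntegral_triangle`).

Path independence is local. Near `x` only those values of `f` occur which `f` attains arbitrarily
close to `x`. For such a value `b`, monotonicity between a point `u` near `x` and points tending to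
`x` where `f` is `b` gives `⟪b, u - x⟫ ≤ ⟪f u, u - x⟫`. Hence `u ↦ ⟪f u, u - x⟫`, locally the
maximum of the linear functionals `⟪b, · - x⟫`, is a potential of `f` near `x`
(`exists_local_potential`). A triangle is cut into a grid of quadrilaterals, each so small that a
local potential is available on it, and the integrals around the quadrilaterals add up to the
integral around the triangle.

For an allocation rule `a`, the payment is `q t = ⟪a t, t⟫ - φ t`. For a cell complex, the cells
cover the space (by Baire's theorem, as the other faces have empty interior), so a selection of
sites is a monotone map with finitely many values; on the cell of `p i` its potential is
`⟪p i, t⟫ + c i`, and the `c i` yield weights for which each cell lies in its power cell. The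
reverse inclusion holds because the segment from an interior point of the cell `i` to a point of the
power cell `i` meets no other power cell before its endpoint.
-/

namespace Elicitation

open Set Filter Topology

/-! ### Integrals of monotone functions on the unit interval -/

theorem natCast_div_mem_Icc {N k : ℕ} (hk : k ≤ N) : (k : ℝ) / N ∈ Icc (0 : ℝ) 1 :=
  ⟨by positivity, div_le_one_of_le₀ (by exact_mod_cast hk) (by positivity)⟩

theorem sum_integral_div_eq {g : ℝ → ℝ} (hg : MonotoneOn g (Icc 0 1)) {N : ℕ} (hN : 0 < N) :
    ∑ k ∈ Finset.range N, ∫ s in ((k : ℝ) / N)..(((k + 1 : ℕ) : ℝ) / N), g s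
      = ∫ s in (0 : ℝ)..1, g s := by
  have hN' : (N : ℝ) ≠ 0 := by positivity
  rw [intervalIntegral.sum_integral_adjacent_intervals (a := fun k : ℕ => (k : ℝ) / N)]
  · simp [hN']
  · intro k hk
    apply MonotoneOn.intervalIntegrable
    apply hg.mono
    exact (convex_Icc (0 : ℝ) 1).ordConnected.uIcc_subset (natCast_div_mem_Icc hk.le)
      (natCast_div_mem_Icc hk)

theorem mul_sub_le_integral {g : ℝ → ℝ} (hg : MonotoneOn g (Icc 0 1)) {a b : ℝ}
    (ha : a ∈ Icc (0 : ℝ) 1) (hb : b ∈ Icc (0 : ℝ) 1) (hab : a ≤ b) :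
    g a * (b - a) ≤ ∫ s in a..b, g s ∧ ∫ s in a..b, g s ≤ g b * (b - a) := by
  have hsub : Icc a b ⊆ Icc 0 1 := Icc_subset_Icc ha.1 hb.2
  have hint : IntervalIntegrable g MeasureTheory.volume a b :=
    MonotoneOn.intervalIntegrable (hg.mono (by rwa [uIcc_of_le hab]))
  constructor
  · have := intervalIntegral.integral_mono_on hab intervalIntegrable_const hint
      (fun s hs => hg ha (hsub hs) hs.1)
    simpa [mul_comm] using this
  · have := intervalIntegral.integral_mono_on hab hint intervalIntegrable_const
      (fun s hs => hg (hsub hs) hb hs.2)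
    simpa [mul_comm] using this

/-- The fundamental theorem of calculus for a selection `g` of the subdifferential of `ψ`. -/
theorem integral_eq_sub_of_subgradient {g ψ : ℝ → ℝ}
    (h : ∀ s ∈ Icc (0 : ℝ) 1, ∀ s' ∈ Icc (0 : ℝ) 1, g s * (s' - s) ≤ ψ s' - ψ s) :
    ∫ s in (0 : ℝ)..1, g s = ψ 1 - ψ 0 := by
  have hg : MonotoneOn g (Icc 0 1) := by
    intro s hs s' hs' hle
    rcases hle.eq_or_lt with rfl | hlt
    · exact le_rfl
    · nlinarith [h s hs s' hs', h s' hs' s hs]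
  -- On an interval of length `1 / N` both sides lie between the lower and the upper Riemann sum.
  have key : ∀ N : ℕ, 0 < N →
      |(∫ s in (0 : ℝ)..1, g s) - (ψ 1 - ψ 0)| ≤ (g 1 - g 0) * (N : ℝ)⁻¹ := by
    intro N hN
    have hN' : (N : ℝ) ≠ 0 := by positivity
    have hψ : ψ 1 - ψ 0 =
        ∑ k ∈ Finset.range N, (ψ (((k + 1 : ℕ) : ℝ) / N) - ψ ((k : ℝ) / N)) := by
      rw [Finset.sum_range_sub (fun k : ℕ => ψ ((k : ℝ) / N))]
      simp [hN']
    have hgs : (g 1 - g 0) * (N : ℝ)⁻¹ = ∑ k ∈ Finset.range N,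
        (g (((k + 1 : ℕ) : ℝ) / N) - g ((k : ℝ) / N)) * (N : ℝ)⁻¹ := by
      rw [← Finset.sum_mul, Finset.sum_range_sub (fun k : ℕ => g ((k : ℝ) / N))]
      simp [hN']
    rw [hψ, hgs, ← sum_integral_div_eq hg hN, ← Finset.sum_sub_distrib]
    refine (Finset.abs_sum_le_sum_abs _ _).trans (Finset.sum_le_sum fun k hk => ?_)
    have hk' : k < N := Finset.mem_range.1 hk
    have ha := natCast_div_mem_Icc hk'.le
    have hb := natCast_div_mem_Icc (Nat.succ_le_of_lt hk')
    have hd : ((k + 1 : ℕ) : ℝ) / N - (k : ℝ) / N = (N : ℝ)⁻¹ := by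
      push_cast
      field_simp
      ring
    have hpos : (0 : ℝ) < (N : ℝ)⁻¹ := by positivity
    have h1 := h _ ha _ hb
    have h2 := h _ hb _ ha
    have h3 := mul_sub_le_integral hg ha hb (by linarith)
    rw [hd] at h1 h3
    rw [← neg_sub, hd] at h2
    rw [abs_le]
    constructor <;> linarith [h3.1, h3.2]
  have hlim : Tendsto (fun N : ℕ => (g 1 - g 0) * (N : ℝ)⁻¹) atTop (𝓝 0) := by
    simpa using tendsto_inv_atTop_nhds_zero_nat.const_mul (g 1 - g 0)
  have h0 := ge_of_tendsto hlim ((eventually_gt_atTop 0).mono key)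
  exact sub_eq_zero.1 (abs_nonpos_iff.1 h0)

/-! ### Path integrals of monotone maps along segments -/

variable {V : Type*} [NormedAddCommGroup V] [InnerProductSpace ℝ V]

/-- The map `f` is monotone on `T`, in the sense of monotone operators. -/
def MonotoneMapOn (f : V → V) (T : Set V) : Prop :=
  ∀ x ∈ T, ∀ y ∈ T, inner ℝ (f x) (y - x) ≤ inner ℝ (f y) (y - x)

/-- The path integral of the vector field `f` along the segment from `u` to `v`. -/
noncomputable def segmentIntegral (f : V → V) (u v : V) : ℝ :=
  ∫ s in (0 : ℝ)..1, inner ℝ (f (AffineMap.lineMap u v s)) (v - u)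

theorem lineMap_sub_lineMap (u v : V) (s s' : ℝ) :
    AffineMap.lineMap u v s' - AffineMap.lineMap u v s = (s' - s) • (v - u) := by
  simp only [AffineMap.lineMap_apply_module']
  module

theorem segmentIntegral_self (f : V → V) (u : V) : segmentIntegral f u u = 0 := by
  simp [segmentIntegral]

theorem segmentIntegral_lineMap (f : V → V) (u v : V) (a b : ℝ) :
    segmentIntegral f (AffineMap.lineMap u v a) (AffineMap.lineMap u v b)
      = ∫ s in a..b, inner ℝ (f (AffineMap.lineMap u v s)) (v - u) := by
  have h := intervalIntegral.smul_integral_comp_add_mul (a := 0) (b := 1)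
    (fun s => inner ℝ (f (AffineMap.lineMap u v s)) (v - u)) (b - a) a
  rw [mul_zero, add_zero, mul_one, add_sub_cancel] at h
  rw [← h, segmentIntegral, ← intervalIntegral.integral_smul]
  congr 1
  ext s
  have e : AffineMap.lineMap (AffineMap.lineMap u v a) (AffineMap.lineMap u v b) s
      = AffineMap.lineMap u v (a + (b - a) * s) := by
    simp only [AffineMap.lineMap_apply_module']
    module
  rw [lineMap_sub_lineMap, inner_smul_right, smul_eq_mul, e]

variable {f : V → V} {T : Set V}

theorem MonotoneMapOn.monotoneOn_segment (hf : MonotoneMapOn f T) (hT : Convex ℝ T) {u v : V}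
    (hu : u ∈ T) (hv : v ∈ T) :
    MonotoneOn (fun s : ℝ => inner ℝ (f (AffineMap.lineMap u v s)) (v - u)) (Icc 0 1) := by
  intro s hs s' hs' hle
  rcases hle.eq_or_lt with rfl | hlt
  · exact le_rfl
  · have := hf _ (hT.lineMap_mem hu hv hs) _ (hT.lineMap_mem hu hv hs')
    rw [lineMap_sub_lineMap, inner_smul_right, inner_smul_right] at this
    exact le_of_mul_le_mul_left this (sub_pos.2 hlt)

theorem MonotoneMapOn.sum_segmentIntegral (hf : MonotoneMapOn f T) (hT : Convex ℝ T) {u v : V}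
    (hu : u ∈ T) (hv : v ∈ T) {N : ℕ} (hN : 0 < N) :
    ∑ k ∈ Finset.range N, segmentIntegral f (AffineMap.lineMap u v ((k : ℝ) / N))
      (AffineMap.lineMap u v (((k + 1 : ℕ) : ℝ) / N)) = segmentIntegral f u v := by
  simp only [segmentIntegral_lineMap]
  exact sum_integral_div_eq (hf.monotoneOn_segment hT hu hv) hN

/-- A vector `b` which extends the graph of `f` monotonically at `x` lies below the path integrals
of `f` that start at `x`. -/
theorem MonotoneMapOn.inner_le_segmentIntegral (hf : MonotoneMapOn f T) (hT : Convex ℝ T)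
    {x y : V} (hx : x ∈ T) (hy : y ∈ T) {b : V}
    (hb : ∀ m ∈ T, inner ℝ b (m - x) ≤ inner ℝ (f m) (m - x)) :
    inner ℝ b (y - x) ≤ segmentIntegral f x y := by
  have hint : IntervalIntegrable (fun s : ℝ => inner ℝ (f (AffineMap.lineMap x y s)) (y - x))
      MeasureTheory.volume 0 1 :=
    MonotoneOn.intervalIntegrable (by
      rw [uIcc_of_le zero_le_one]
      exact hf.monotoneOn_segment hT hx hy)
  have := intervalIntegral.integral_mono_on_of_le_Ioo zero_le_one
    (intervalIntegrable_const (c := (inner ℝ b (y - x) : ℝ))) hint (fun s hs => by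
      have h := hb _ (hT.lineMap_mem hx hy (Ioo_subset_Icc_self hs))
      have e : AffineMap.lineMap x y s - x = s • (y - x) := by
        simp [AffineMap.lineMap_apply_module']
      rw [e, inner_smul_right, inner_smul_right] at h
      exact le_of_mul_le_mul_left h hs.1)
  simpa [segmentIntegral] using this

/-! ### Path independence -/

/-- Near `x` the function `u ↦ ⟪f u, u - x⟫` is a potential of `f`. -/
theorem MonotoneMapOn.exists_local_potential (hf : MonotoneMapOn f T) (hfin : (f '' T).Finite)
    (x : V) : ∃ ε > 0, ∀ u ∈ T, u ∈ Metric.ball x ε → ∀ v ∈ T,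
      inner ℝ (f u) (v - u) ≤ inner ℝ (f v) (v - x) - inner ℝ (f u) (u - x) := by
  -- A value not attained arbitrarily close to `x` is avoided on some neighbourhood of `x`.
  have hev : ∀ b ∈ f '' T, ∀ᶠ u in 𝓝 x, u ∈ T → f u = b → x ∈ closure {m ∈ T | f m = b} := by
    intro b _
    by_cases hb : x ∈ closure {m ∈ T | f m = b}
    · exact Eventually.of_forall fun _ _ _ => hb
    · filter_upwards [isClosed_closure.isOpen_compl.mem_nhds hb] with u hu huT hub
      exact absurd (subset_closure (show u ∈ {m ∈ T | f m = b} from ⟨huT, hub⟩)) hu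
  obtain ⟨ε, hε, h⟩ := Metric.eventually_nhds_iff_ball.1 ((eventually_all_finite hfin).2 hev)
  refine ⟨ε, hε, fun u hu hux v hv => ?_⟩
  have hcl := h u hux (f u) ⟨u, hu, rfl⟩ hu rfl
  have hle : (inner ℝ (f v) (x - v) : ℝ) ≤ inner ℝ (f u) (x - v) := by
    refine closure_minimal (s := {m ∈ T | f m = f u})
      (t := {m | (inner ℝ (f v) (m - v) : ℝ) ≤ inner ℝ (f u) (m - v)}) ?_ ?_ hcl
    · rintro m ⟨hm, hmu⟩
      have := hf v hv m hm
      rwa [hmu] at this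
    · exact isClosed_le (by fun_prop) (by fun_prop)
  simp only [inner_sub_right] at hle ⊢
  linarith

/-- The local potential computes the path integrals near `x`. -/
theorem MonotoneMapOn.exists_segmentIntegral_eq (hf : MonotoneMapOn f T) (hT : Convex ℝ T)
    (hfin : (f '' T).Finite) (x : V) : ∃ ε > 0, ∀ u ∈ T, u ∈ Metric.ball x ε →
      ∀ v ∈ T, v ∈ Metric.ball x ε →
        segmentIntegral f u v = inner ℝ (f v) (v - x) - inner ℝ (f u) (u - x) := by
  obtain ⟨ε, hε, h⟩ := hf.exists_local_potential hfin x
  refine ⟨ε, hε, fun u hu hux v hv hvx => ?_⟩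
  have := integral_eq_sub_of_subgradient
    (g := fun s : ℝ => inner ℝ (f (AffineMap.lineMap u v s)) (v - u))
    (ψ := fun s : ℝ => inner ℝ (f (AffineMap.lineMap u v s)) (AffineMap.lineMap u v s - x))
    (fun s hs s' hs' => by
      have := h _ (hT.lineMap_mem hu hv hs) ((convex_ball x ε).lineMap_mem hux hvx hs) _
        (hT.lineMap_mem hu hv hs')
      rwa [lineMap_sub_lineMap, inner_smul_right, mul_comm] at this)
  simpa [segmentIntegral] using this

/-- The path integral of `f` around a triangle in `T` vanishes. -/
theorem MonotoneMapOn.segmentIntegral_triangle (hf : MonotoneMapOn f T) (hT : Convex ℝ T)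
    (hfin : (f '' T).Finite) {x₀ x y : V} (hx₀ : x₀ ∈ T) (hx : x ∈ T) (hy : y ∈ T) :
    segmentIntegral f x₀ y - segmentIntegral f x₀ x = segmentIntegral f x y := by
  choose ε hε hloc using hf.exists_segmentIntegral_eq hT hfin
  -- The unit square parametrizes the triangle, one edge being collapsed to the vertex `x₀`.
  let h : ℝ × ℝ → V := fun r => AffineMap.lineMap x₀ (AffineMap.lineMap x y r.1) r.2
  have hcont : Continuous h := by
    simp only [h, AffineMap.lineMap_apply_module']
    fun_prop
  have hmem : ∀ r ∈ Icc (0 : ℝ) 1 ×ˢ Icc (0 : ℝ) 1, h r ∈ T := fun r hr =>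
    hT.lineMap_mem hx₀ (hT.lineMap_mem hx hy hr.1) hr.2
  obtain ⟨δ, hδ, hcov⟩ := lebesgue_number_lemma_of_metric
    (s := Icc (0 : ℝ) 1 ×ˢ Icc (0 : ℝ) 1) (c := fun z : V => h ⁻¹' Metric.ball z (ε z))
    (isCompact_Icc.prod isCompact_Icc) (fun z => Metric.isOpen_ball.preimage hcont)
    (fun r _ => mem_iUnion.2 ⟨h r, Metric.mem_ball_self (hε _)⟩)
  obtain ⟨n, hn⟩ := exists_nat_one_div_lt hδ
  set N := n + 1 with hNdef
  have hN : 0 < N := Nat.succ_pos n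
  have hN' : (N : ℝ) ≠ 0 := by positivity
  let P : ℕ → ℕ → V := fun i j => h ((i : ℝ) / N, (j : ℝ) / N)
  have hstep : ∀ k : ℕ, dist (((k + 1 : ℕ) : ℝ) / N) ((k : ℝ) / N) < δ := by
    intro k
    have e : ((k + 1 : ℕ) : ℝ) / N - (k : ℝ) / N = 1 / ((n : ℝ) + 1) := by
      rw [hNdef]
      push_cast
      field_simp
      ring
    rw [Real.dist_eq, e, abs_of_pos (by positivity)]
    exact hn
  -- Each grid quadrilateral lies in a ball with a local potential. Summed over `j`, the integrals
  -- over the columns telescope; summed over `i`, those over the rows do.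
  have hquad : ∀ i < N, ∀ j < N,
      segmentIntegral f (P i j) (P i (j + 1)) - segmentIntegral f (P (i + 1) j) (P (i + 1) (j + 1))
        + (segmentIntegral f (P i (j + 1)) (P (i + 1) (j + 1))
          - segmentIntegral f (P i j) (P (i + 1) j)) = 0 := by
    intro i hi j hj
    have mi := natCast_div_mem_Icc hi.le
    have mi' := natCast_div_mem_Icc (Nat.succ_le_of_lt hi)
    have mj := natCast_div_mem_Icc hj.le
    have mj' := natCast_div_mem_Icc (Nat.succ_le_of_lt hj)
    obtain ⟨z, hz⟩ := hcov ((i : ℝ) / N, (j : ℝ) / N) ⟨mi, mj⟩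
    have b00 : P i j ∈ Metric.ball z (ε z) := hz (Metric.mem_ball_self hδ)
    have b01 : P i (j + 1) ∈ Metric.ball z (ε z) :=
      hz (by rw [Metric.mem_ball, Prod.dist_eq]; exact max_lt (by simpa using hδ) (hstep j))
    have b10 : P (i + 1) j ∈ Metric.ball z (ε z) :=
      hz (by rw [Metric.mem_ball, Prod.dist_eq]; exact max_lt (hstep i) (by simpa using hδ))
    have b11 : P (i + 1) (j + 1) ∈ Metric.ball z (ε z) :=
      hz (by rw [Metric.mem_ball, Prod.dist_eq]; exact max_lt (hstep i) (hstep j))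
    have t00 : P i j ∈ T := hmem _ ⟨mi, mj⟩
    have t01 : P i (j + 1) ∈ T := hmem _ ⟨mi, mj'⟩
    have t10 : P (i + 1) j ∈ T := hmem _ ⟨mi', mj⟩
    have t11 : P (i + 1) (j + 1) ∈ T := hmem _ ⟨mi', mj'⟩
    rw [hloc z _ t00 b00 _ t01 b01, hloc z _ t10 b10 _ t11 b11, hloc z _ t01 b01 _ t11 b11,
      hloc z _ t00 b00 _ t10 b10]
    ring
  have hP0 : ∀ i, P i 0 = x₀ := fun i => by simp [P, h]
  have hPN : ∀ i : ℕ, P i N = AffineMap.lineMap x y ((i : ℝ) / N) := fun i => by simp [P, h, hN']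
  have hrow : ∀ i ≤ N, ∑ j ∈ Finset.range N, segmentIntegral f (P i j) (P i (j + 1))
      = segmentIntegral f x₀ (P i N) := by
    intro i hi
    rw [hPN]
    exact hf.sum_segmentIntegral hT hx₀ (hT.lineMap_mem hx hy (natCast_div_mem_Icc hi)) hN
  have hstrip : ∀ i < N, segmentIntegral f (P i N) (P (i + 1) N)
      = segmentIntegral f x₀ (P (i + 1) N) - segmentIntegral f x₀ (P i N) := by
    intro i hi
    have := Finset.sum_eq_zero fun j hj => hquad i hi j (Finset.mem_range.1 hj)
    rw [Finset.sum_add_distrib, Finset.sum_sub_distrib, hrow i hi.le, hrow (i + 1) hi,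
      Finset.sum_range_sub (fun j => segmentIntegral f (P i j) (P (i + 1) j)), hP0, hP0,
      segmentIntegral_self] at this
    linarith
  have hsum := hf.sum_segmentIntegral hT hx hy hN
  simp only [← hPN] at hsum
  rw [Finset.sum_congr rfl fun i hi => hstrip i (Finset.mem_range.1 hi),
    Finset.sum_range_sub (fun i => segmentIntegral f x₀ (P i N))] at hsum
  simpa [hPN, hN'] using hsum

/-- A monotone map with finitely many values on a convex set has a potential. Vectors `b` other than
`f x` are admitted so that the potential also serves set-valued extensions of `f`. -/
theorem MonotoneMapOn.exists_potential (hf : MonotoneMapOn f T) (hT : Convex ℝ T)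
    (hfin : (f '' T).Finite) : ∃ φ : V → ℝ, ∀ x ∈ T, ∀ y ∈ T, ∀ b : V,
      (∀ m ∈ T, inner ℝ b (m - x) ≤ inner ℝ (f m) (m - x)) →
        inner ℝ b (y - x) ≤ φ y - φ x := by
  rcases T.eq_empty_or_nonempty with rfl | ⟨x₀, hx₀⟩
  · exact ⟨0, by simp⟩
  · refine ⟨segmentIntegral f x₀, fun x hx y hy b hb => ?_⟩
    rw [hf.segmentIntegral_triangle hT hfin hx₀ hx hy]
    exact hf.inner_le_segmentIntegral hT hx hy hb

/-! ### Allocation rules -/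

theorem isImplementable_iff_ruleWMON (hT : Convex ℝ T) {A : Set V} (hA : A.Finite)
    {a : T → V} (ha : ∀ t, a t ∈ A) : IsImplementable a ↔ RuleWMON a := by
  constructor
  · rintro ⟨q, hq⟩ t t'
    have h1 := hq t t'
    have h2 := hq t' t
    simp only [utility] at h1 h2
    simp only [inner_sub_right]
    linarith
  · intro h
    classical
    let f : V → V := fun x => if hx : x ∈ T then a ⟨x, hx⟩ else 0
    have hfa : ∀ t : T, f t = a t := fun t => by simp [f]
    have hf : MonotoneMapOn f T := fun x hx y hy => by
      simpa only [hfa ⟨x, hx⟩, hfa ⟨y, hy⟩] using h ⟨x, hx⟩ ⟨y, hy⟩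
    have hfin : (f '' T).Finite := hA.subset (by
      rintro _ ⟨x, hx, rfl⟩
      rw [hfa ⟨x, hx⟩]
      exact ha _)
    obtain ⟨φ, hφ⟩ := hf.exists_potential hT hfin
    refine ⟨fun t => inner ℝ (a t) (t : V) - φ t, fun t t' => ?_⟩
    have := hφ t' t'.2 t t.2 (f t') (fun m hm => hf _ t'.2 m hm)
    rw [hfa, inner_sub_right] at this
    simp only [utility]
    linarith

/-! ### Cell complexes -/

theorem IsPolyhedron.isClosed_and_convex {j : ℕ} {F : Set V} (hF : IsPolyhedron j F) :
    IsClosed F ∧ Convex ℝ F := by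
  obtain ⟨-, ⟨H, -, hH, rfl⟩, -⟩ := hF
  constructor
  · refine isClosed_sInter fun h hh => ?_
    obtain ⟨a, b, -, rfl⟩ := hH h hh
    exact isClosed_le (by fun_prop) continuous_const
  · refine convex_sInter fun h hh => ?_
    obtain ⟨a, b, -, rfl⟩ := hH h hh
    exact convex_halfSpace_le (innerₛₗ ℝ a).isLinear b

theorem CellComplex.mem_cells_of_interior_nonempty [FiniteDimensional ℝ V] (C : CellComplex V)
    {F : Set V} (hF : F ∈ C.faces) (hne : (interior F).Nonempty) : F ∈ C.cells := by
  obtain ⟨j, hj⟩ := C.polyhedral F hF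
  have htop : affineSpan ℝ F = ⊤ :=
    hj.isClosed_and_convex.2.interior_nonempty_iff_affineSpan_eq_top.1 hne
  have : vectorSpan ℝ F = ⊤ := by
    rw [← direction_affineSpan, htop, AffineSubspace.direction_top]
  exact ⟨hF, hj.1, hj.2.1, by rw [this, finrank_top]⟩

theorem CellComplex.interior_nonempty_of_mem_cells [FiniteDimensional ℝ V] (C : CellComplex V)
    {F : Set V} (hF : F ∈ C.cells) : (interior F).Nonempty := by
  obtain ⟨-, hF⟩ := hF
  rw [hF.isClosed_and_convex.2.interior_nonempty_iff_affineSpan_eq_top,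
    AffineSubspace.affineSpan_eq_top_iff_vectorSpan_eq_top_of_nonempty ℝ V V hF.1]
  exact Submodule.eq_top_of_finrank_eq hF.2.2

/-- The cells cover the space: the interiors of the faces have a dense union by Baire's theorem, and
only cells have interior points. -/
theorem CellComplex.exists_mem_cells [FiniteDimensional ℝ V] (C : CellComplex V) (x : V) :
    ∃ F ∈ C.cells, x ∈ F := by
  have : CompleteSpace V := FiniteDimensional.complete ℝ V
  have hdense : Dense (⋃ F ∈ C.faces, interior F) :=
    dense_biUnion_interior_of_closed
      (fun F hF => (C.polyhedral F hF).choose_spec.isClosed_and_convex.1)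
      C.finite_faces.countable (by rw [← sUnion_eq_biUnion, C.cover])
  have hsub : (⋃ F ∈ C.faces, interior F) ⊆ ⋃ F ∈ C.cells, F := by
    intro y hy
    obtain ⟨F, hF, hyF⟩ := mem_iUnion₂.1 hy
    exact mem_iUnion₂.2 ⟨F, C.mem_cells_of_interior_nonempty hF ⟨y, hyF⟩, interior_subset hyF⟩
  have hclosed : IsClosed (⋃ F ∈ C.cells, F) :=
    (C.finite_faces.subset fun _ hF => hF.1).isClosed_biUnion
      fun F hF => hF.2.isClosed_and_convex.1
  have hx : x ∈ ⋃ F ∈ C.cells, F := by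
    rw [← hclosed.closure_eq, (hdense.mono hsub).closure_eq]
    trivial
  simpa only [mem_iUnion, exists_prop] using hx

/-! ### Power diagrams -/

theorem IsPowerDiagram.cellsWMON {n : ℕ} {Z : Fin n → Set V} {p : Fin n → V}
    (h : IsPowerDiagram Z p) : CellsWMON Z p := by
  obtain ⟨w, hw⟩ := h
  intro i j t ht t' ht'
  rw [hw] at ht ht'
  have h1 := ht j
  have h2 := ht' i
  simp only [@norm_sub_sq_real V] at h1 h2
  simp only [inner_sub_right]
  linarith

/-- Up to `‖t‖ ^ 2`, the power distance of `t` to the site `p j` of weight `‖p j‖ ^ 2 + 2 * c j` is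
`-2` times the affine function `⟪p j, t⟫ + c j`. -/
theorem mem_powerCell_iff {n : ℕ} {p : Fin n → V} {c : Fin n → ℝ} {i : Fin n} {t : V} :
    t ∈ powerCell p (fun j => ‖p j‖ ^ 2 + 2 * c j) i ↔
      ∀ j, inner ℝ (p j) t + c j ≤ inner ℝ (p i) t + c i := by
  refine forall_congr' fun j => ?_
  simp only [@norm_sub_sq_real V]
  constructor <;> intro h <;> linarith

/-- In the interior of the set where an affine function is nonnegative, it is positive. -/
theorem inner_add_pos_of_mem_interior {b : V} (hb : b ≠ 0) {c : ℝ} {S : Set V}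
    (hS : ∀ y ∈ S, 0 ≤ inner ℝ b y + c) {z : V} (hz : z ∈ interior S) :
    0 < inner ℝ b z + c := by
  have hcont : Tendsto (fun r : ℝ => z - r • b) (𝓝[>] 0) (𝓝 z) := by
    have : Continuous fun r : ℝ => z - r • b := by fun_prop
    simpa using (this.tendsto 0).mono_left nhdsWithin_le_nhds
  obtain ⟨r, hr, hr0⟩ := ((hcont.eventually (mem_interior_iff_mem_nhds.1 hz)).and
    self_mem_nhdsWithin).exists
  have h := hS _ hr
  rw [inner_sub_right, inner_smul_right, real_inner_self_eq_norm_sq] at h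
  have : 0 < r * ‖b‖ ^ 2 := mul_pos hr0 (by positivity)
  linarith

theorem CellsWMON.isPowerDiagram [FiniteDimensional ℝ V] {C : CellComplex V} {n : ℕ}
    {Z : Fin n → Set V} (hZ : C.IsEnumeration Z) {p : Fin n → V} (hp : Function.Injective p)
    (h : CellsWMON Z p) : IsPowerDiagram Z p := by
  have hcell : ∀ i, Z i ∈ C.cells := fun i => hZ.2 ▸ mem_range_self i
  have hcov : ∀ x, ∃ i, x ∈ Z i := by
    intro x
    obtain ⟨F, hF, hx⟩ := C.exists_mem_cells x
    rw [← hZ.2] at hF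
    obtain ⟨i, rfl⟩ := hF
    exact ⟨i, hx⟩
  choose σ hσ using hcov
  choose z hz using fun i => C.interior_nonempty_of_mem_cells (hcell i)
  have hf : MonotoneMapOn (p ∘ σ) univ := fun x _ y _ => h _ _ x (hσ x) y (hσ y)
  obtain ⟨φ, hφ⟩ := hf.exists_potential convex_univ
    ((finite_range p).subset (by rintro _ ⟨x, -, rfl⟩; exact mem_range_self (σ x)))
  have hsub : ∀ i, ∀ t ∈ Z i, ∀ y, inner ℝ (p i) (y - t) ≤ φ y - φ t := fun i t ht y =>
    hφ t trivial y trivial (p i) fun m _ => h i (σ m) t ht m (hσ m)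
  let c : Fin n → ℝ := fun i => φ (z i) - inner ℝ (p i) (z i)
  have hc : ∀ i, ∀ t ∈ Z i, ∀ j, inner ℝ (p j) t + c j ≤ inner ℝ (p i) t + c i := by
    intro i t ht j
    have h1 := hsub j (z j) (interior_subset (hz j)) t
    have h2 := hsub i t ht (z i)
    simp only [inner_sub_right] at h1 h2
    simp only [c]
    linarith
  refine ⟨fun j => ‖p j‖ ^ 2 + 2 * c j, fun i => Subset.antisymm
    (fun t ht => mem_powerCell_iff.2 (hc i t ht)) fun t ht => ?_⟩
  rw [mem_powerCell_iff] at ht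
  have hstrict : ∀ j, j ≠ i → inner ℝ (p j) (z i) + c j < inner ℝ (p i) (z i) + c i := by
    intro j hj
    have := inner_add_pos_of_mem_interior (b := p i - p j) (c := c i - c j) (S := Z i)
      (sub_ne_zero.2 (hp.ne hj.symm))
      (fun y hy => by rw [inner_sub_left]; linarith [hc i y hy j]) (hz i)
    rw [inner_sub_left] at this
    linarith
  -- On the segment from `z i` to `t`, `i` is the only maximizer until `t` is reached.
  have hseg : ∀ r ∈ Ioc (0 : ℝ) 1, AffineMap.lineMap t (z i) r ∈ Z i := by
    intro r hr
    by_contra hnot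
    have hne : σ (AffineMap.lineMap t (z i) r) ≠ i := by
      intro e
      have := hσ (AffineMap.lineMap t (z i) r)
      rw [e] at this
      exact hnot this
    have h1 := hc _ _ (hσ (AffineMap.lineMap t (z i) r)) i
    have h2 := ht (σ (AffineMap.lineMap t (z i) r))
    have h3 := hstrict _ hne
    generalize σ (AffineMap.lineMap t (z i) r) = k at h1 h2 h3
    simp only [AffineMap.lineMap_apply_module, inner_add_right, inner_smul_right] at h1
    nlinarith [mul_lt_mul_of_pos_left h3 hr.1,
      mul_le_mul_of_nonneg_left h2 (sub_nonneg.2 hr.2)]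
  have hlim : Tendsto (fun r : ℝ => AffineMap.lineMap t (z i) r) (𝓝[>] 0) (𝓝 t) := by
    have : Continuous fun r : ℝ => AffineMap.lineMap t (z i) r := AffineMap.lineMap_continuous
    simpa using (this.tendsto 0).mono_left nhdsWithin_le_nhds
  refine (hcell i).2.isClosed_and_convex.1.mem_of_tendsto hlim ?_
  filter_upwards [Ioc_mem_nhdsGT (zero_lt_one (α := ℝ))] with r hr using hseg r hr

end Elicitation

theorem mainTheorem6 {V : Type*} [NormedAddCommGroup V] [InnerProductSpace ℝ V] :
    (∀ [FiniteDimensional ℝ V] (C : Elicitation.CellComplex V) (n : ℕ)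
        (Z : Fin n → Set V) (_ : C.IsEnumeration Z)
        (p : Fin n → V) (_ : Function.Injective p),
      Elicitation.IsPowerDiagram Z p ↔ Elicitation.CellsWMON Z p) ∧
    (∀ (T : Set V) (_ : Convex ℝ T) (A : Set V) (_ : A.Finite)
        (a : T → V) (_ : ∀ t, a t ∈ A),
      Elicitation.IsImplementable a ↔ Elicitation.RuleWMON a) :=
  ⟨fun _ _ _ hZ _ hp => ⟨fun h => h.cellsWMON, fun h => h.isPowerDiagram hZ hp⟩,
    fun _ hT _ hA _ ha => Elicitation.isImplementable_iff_ruleWMON hT hA ha⟩
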